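/- Let $X$ be a closed (compact, connected) Riemann surface and $q$ a holomorphic quadratic differential on $X$ of total area $\int_X|q|=1$; write $|A|$ for the $|q|$-area of $A\subset X$. For $t\in\mathbb R$ let $X_t$ be the surface obtained from $X$ by post-composing the natural parameters $\zeta$ of $q$ (the local coordinates away from the zeroes of $q$ with $d\zeta=q^{1/2}$) with the map $x+iy\mapsto e^{t/2}x+ie^{-t/2}y$, and let $f_t:X\to X_t$ be the Teichmüller map (the identity on points). A *rectangle* in $X_t$ is a map from a product of two bounded nondegenerate intervals in $\mathbb R\times\mathbb R=\mathbb C$ to $X_t$ which in natural parameters of $X_t$ is locally of the form $z\mapsto \pm z+b$; it is a *square* of side $\sigma$ if both intervals have length $\sigma$, and it is *embedded* if it is injective. For $\alpha>0$, a rectangle is *$\alpha$-buffered* if it extends in the vertical direction (same horizontal interval, vertical interval containing the given one) to a rectangle whose product of sides is at least $\alpha$ and which overlaps itself at most once (it covers every point at most twice). For all $c>0$ and $\alpha>0$ there is a constant $K=K(c,\alpha)$, depending only on $c$ and $\alpha$, such that the following holds for every $(X,q)$ as above, every $0<\varepsilon\le 1$ and every $T\ge 0$. Suppose that for every $t>T$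 we are given an $\alpha$-buffered embedded square $S_t$ in $X_t$ of side $\sigma_t>c/t^{\varepsilon/2}$. Then there is a sequence $(t_n)$ in $(T,\infty)$ with $t_n\to\infty$ and $t_n=O(n\log n\log\log n)$ such that the sets $A_n=f_{t_n}^{-1}(S_{t_n})\subset X$ satisfy $$|A_n\cap A_m|\le K\,|A_n|\,|A_m|\qquad\text{for all } m>n .$$ -/

import Mathlib

open Set Filter Topology MeasureTheory Asymptotics
open scoped Manifold ContDiff ENNReal

universe u

/-- A holomorphic quadratic differential on a Riemann surface `X`: in each chart `φ` of the
holomorphic atlas it is `coeff φ dz²` with `coeff φ` holomorphic on the range of the chart, and the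
local expressions agree on overlaps.  (Values of `coeff` elsewhere are irrelevant.) -/
structure QuadraticDifferential (X : Type u) [TopologicalSpace X] [ChartedSpace ℂ X] where
  coeff : OpenPartialHomeomorph X ℂ → ℂ → ℂ
  holomorphic : ∀ φ ∈ atlas ℂ X, DifferentiableOn ℂ (coeff φ) φ.target
  compatible : ∀ φ ∈ atlas ℂ X, ∀ ψ ∈ atlas ℂ X, ∀ p ∈ φ.source ∩ ψ.source,
    coeff φ (φ p) = coeff ψ (ψ p) * deriv (ψ ∘ φ.symm) (φ p) ^ 2

/-- A map from a product of two bounded nondegenerate intervals into `Y`.  The intervals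
`hor` and `ver` may or may not contain their endpoints. -/
structure RectangleMap (Y : Type u) where
  left : ℝ
  right : ℝ
  bottom : ℝ
  top : ℝ
  left_lt_right : left < right
  bottom_lt_top : bottom < top
  hor : Set ℝ
  ver : Set ℝ
  Ioo_subset_hor : Ioo left right ⊆ hor
  hor_subset_Icc : hor ⊆ Icc left right
  Ioo_subset_ver : Ioo bottom top ⊆ ver
  ver_subset_Icc : ver ⊆ Icc bottom top
  toFun : ℂ → Y

namespace RectangleMap

variable {Y : Type u}

def domain (R : RectangleMap Y) : Set ℂ := R.hor ×ℂ R.ver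

def width (R : RectangleMap Y) : ℝ := R.right - R.left

def height (R : RectangleMap Y) : ℝ := R.top - R.bottom

/-- The underlying subset of `Y`. -/
def image (R : RectangleMap Y) : Set Y := R.toFun '' R.domain

def IsEmbedded (R : RectangleMap Y) : Prop := InjOn R.toFun R.domain

def IsSquare (R : RectangleMap Y) (σ : ℝ) : Prop := R.width = σ ∧ R.height = σ

/-- No point of `Y` is covered more than twice. -/
def OverlapsAtMostOnce (R : RectangleMap Y) : Prop :=
  ∀ p : Y, {z | z ∈ R.domain ∧ R.toFun z = p}.encard ≤ 2

/-- `B` extends `R` in the vertical direction. -/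
def IsVerticalExtension (B R : RectangleMap Y) : Prop :=
  B.hor = R.hor ∧ R.ver ⊆ B.ver ∧ EqOn B.toFun R.toFun R.domain

end RectangleMap

/-- The real-linear map `x + iy ↦ e^{t/2} x + i e^{-t/2} y` of the plane. -/
noncomputable def teichmullerLinear (t : ℝ) : ℂ ≃ₜ ℂ where
  toFun z := ⟨Real.exp (t / 2) * z.re, Real.exp (-t / 2) * z.im⟩
  invFun z := ⟨Real.exp (-t / 2) * z.re, Real.exp (t / 2) * z.im⟩
  left_inv z := by
    apply Complex.ext <;> simp only [← mul_assoc, ← Real.exp_add] <;> ring_nf <;> simp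
  right_inv z := by
    apply Complex.ext <;> simp only [← mul_assoc, ← Real.exp_add] <;> ring_nf <;> simp
  continuous_toFun := by
    have : Continuous fun z : ℂ => Complex.equivRealProdCLM.symm
        (Real.exp (t / 2) * z.re, Real.exp (-t / 2) * z.im) := by fun_prop
    exact this
  continuous_invFun := by
    have : Continuous fun z : ℂ => Complex.equivRealProdCLM.symm
        (Real.exp (-t / 2) * z.re, Real.exp (t / 2) * z.im) := by fun_prop
    exact this

namespace QuadraticDifferential

section Flow

variable {X : Type u} [TopologicalSpace X] [ChartedSpace ℂ X] (q : QuadraticDifferential X)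

/-- The natural parameters of `q`: local coordinates `ζ` defined away from the zeroes of `q`
with `dζ = q^{1/2}` (up to sign), that is `(dζ)² = q`. -/
def naturalParameters : Set (OpenPartialHomeomorph X ℂ) :=
  {ζ | ∀ p ∈ ζ.source, ∀ φ ∈ atlas ℂ X, p ∈ φ.source →
    q.coeff φ (φ p) ≠ 0 ∧
      ∃ d : ℂ, HasDerivAt (ζ ∘ φ.symm) d (φ p) ∧ d ^ 2 = q.coeff φ (φ p)}

/-- The surface `X_t`.  It has the same points and the same topology as `X`; what changes is the
atlas of natural parameters `QuadraticDifferential.flowParameters`, which determines the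
complex structure and the quadratic differential of `X_t`. -/
def FlowSurface (_q : QuadraticDifferential X) (_t : ℝ) : Type u := X

instance (t : ℝ) : TopologicalSpace (q.FlowSurface t) := inferInstanceAs (TopologicalSpace X)

/-- The Teichmüller map `f_t : X → X_t`. -/
def teichmullerMap (t : ℝ) : X ≃ₜ q.FlowSurface t := Homeomorph.refl X

/-- The natural parameters of `X_t`: those of `X`, transported by `f_t` and post-composed with
`x + iy ↦ e^{t/2} x + i e^{-t/2} y`. -/
def flowParameters (t : ℝ) : Set (OpenPartialHomeomorph (q.FlowSurface t) ℂ) :=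
  {ξ | ∃ ζ ∈ q.naturalParameters,
    ξ = (q.teichmullerMap t).symm.toOpenPartialHomeomorph.trans
      (ζ.transHomeomorph (teichmullerLinear t))}

/-- `R` is a rectangle in `X_t`: its natural parameter pulls back to `±dz`, that is, near each point
of its domain, `R` reads `z ↦ ±z + b` in some natural parameter of `X_t`. -/
def IsRectangle (t : ℝ) (R : RectangleMap (q.FlowSurface t)) : Prop :=
  ∀ z ∈ R.domain, ∃ ξ ∈ q.flowParameters t, ∃ s b : ℂ, (s = 1 ∨ s = -1) ∧
    ∀ᶠ w in 𝓝[R.domain] z, R.toFun w ∈ ξ.source ∧ ξ (R.toFun w) = s * w + b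

/-- The preimage in `X` under `f_t` of (the underlying set of) `R`. -/
def pullback (t : ℝ) (R : RectangleMap (q.FlowSurface t)) : Set X :=
  q.teichmullerMap t ⁻¹' R.image

/-- `R` extends in the vertical direction to a rectangle in `X_t` with product of sides at least `α`
that overlaps itself at most once. -/
def IsBuffered (t α : ℝ) (R : RectangleMap (q.FlowSurface t)) : Prop :=
  ∃ B : RectangleMap (q.FlowSurface t), q.IsRectangle t B ∧ B.IsVerticalExtension R ∧
    α ≤ B.width * B.height ∧ B.OverlapsAtMostOnce

end Flow

section Area

/-- A compact Riemann surface is covered by countably many coordinate charts. -/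
theorem exists_chart_cover (X : Type u) [TopologicalSpace X] [CompactSpace X] [Nonempty X]
    [ChartedSpace ℂ X] : ∃ c : ℕ → X, ⋃ n, (chartAt ℂ (c n)).source = univ := by
  obtain ⟨s, hs, hc⟩ := countable_cover_nhds_of_sigmaCompact
    (fun x : X => chart_source_mem_nhds ℂ x)
  have hne : s.Nonempty := by
    by_contra h
    rw [not_nonempty_iff_eq_empty] at h
    subst h
    rw [biUnion_empty] at hc
    exact empty_ne_univ hc
  obtain ⟨c, rfl⟩ := hs.exists_eq_range hne
  exact ⟨c, by simpa using hc⟩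

variable {X : Type u} [TopologicalSpace X] [ChartedSpace ℂ X]

theorem hasDerivAt_transition [IsManifold 𝓘(ℂ) 1 X] {φ ψ : OpenPartialHomeomorph X ℂ}
    (hφ : φ ∈ atlas ℂ X) (hψ : ψ ∈ atlas ℂ X) {p : X} (hp : p ∈ φ.source ∩ ψ.source) :
    HasDerivAt (ψ ∘ φ.symm) (deriv (ψ ∘ φ.symm) (φ p)) (φ p) := by
  have h := (contDiffGroupoid 1 𝓘(ℂ)).compatible hφ hψ
  rw [contDiffGroupoid, mem_groupoid_of_pregroupoid] at h
  have h1 : ContDiffOn ℂ 1 (ψ ∘ φ.symm) (φ.symm.trans ψ).source := by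
    simpa [contDiffPregroupoid] using h.1
  have hz : φ p ∈ (φ.symm.trans ψ).source := by
    simp [φ.map_source hp.1, φ.left_inv hp.1, hp.2]
  exact ((h1.differentiableOn one_ne_zero).differentiableAt
    ((φ.symm.trans ψ).open_source.mem_nhds hz)).hasDerivAt

variable [MeasurableSpace X]

/-- The measure `|coeff φ| dx dy` of the chart `φ`, transported to `X`. -/
noncomputable def chartArea (q : QuadraticDifferential X) (φ : OpenPartialHomeomorph X ℂ) :
    Measure X :=
  ((volume.restrict φ.target).withDensity fun z => ‖q.coeff φ z‖ₑ).map φ.symm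

/-- A sequence of charts whose sources cover `X`. -/
noncomputable def coverChart (X : Type u) [TopologicalSpace X] [CompactSpace X] [Nonempty X]
    [ChartedSpace ℂ X] (n : ℕ) : OpenPartialHomeomorph X ℂ :=
  chartAt ℂ ((exists_chart_cover X).choose n)

/-- The area measure `|q|` of the flat metric of `q`, obtained by gluing the chart measures
`|coeff φ| dx dy` along a countable measurable partition of `X`.  It does not depend on
the partition, see `QuadraticDifferential.area_apply`. -/
noncomputable def area [CompactSpace X] [Nonempty X] (q : QuadraticDifferential X) : Measure X :=
  Measure.sum fun n => (q.chartArea (coverChart X n)).restrict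
    (disjointed (fun k => (coverChart X k).source) n)

variable [BorelSpace X]

theorem measurableSet_chart_image (φ : OpenPartialHomeomorph X ℂ) {E : Set X}
    (hE : MeasurableSet E) (hEφ : E ⊆ φ.source) : MeasurableSet (φ '' E) := by
  have h1 : Measurable (fun z : φ.target => φ.symm z) :=
    (continuousOn_iff_continuous_domRestrict.1 φ.continuousOn_symm).measurable
  have h2 := φ.open_target.measurableSet.subtype_image (h1 hE)
  rw [φ.image_eq_target_inter_inv_preimage hEφ]
  convert h2 using 1
  ext z
  simp [and_comm]

theorem lintegral_chart_eq [IsManifold 𝓘(ℂ) 1 X] (q : QuadraticDifferential X) {φ ψ : OpenPartialHomeomorph X ℂ}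
    (hφ : φ ∈ atlas ℂ X) (hψ : ψ ∈ atlas ℂ X) {E : Set X} (hE : MeasurableSet E)
    (hEφ : E ⊆ φ.source) (hEψ : E ⊆ ψ.source) :
    ∫⁻ z in ψ '' E, ‖q.coeff ψ z‖ₑ = ∫⁻ z in φ '' E, ‖q.coeff φ z‖ₑ := by
  have himg : ψ '' E = (ψ ∘ φ.symm) '' (φ '' E) := by
    rw [image_image]
    refine image_congr fun p hp => ?_
    simp [φ.left_inv (hEφ hp)]
  have hinj : InjOn (ψ ∘ φ.symm) (φ '' E) := by
    rintro _ ⟨p, hp, rfl⟩ _ ⟨p', hp', rfl⟩ h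
    simp only [Function.comp, φ.left_inv (hEφ hp), φ.left_inv (hEφ hp')] at h
    rw [ψ.injOn (hEψ hp) (hEψ hp') h]
  have hmeas := measurableSet_chart_image φ hE hEφ
  have hder : ∀ z ∈ φ '' E, HasFDerivWithinAt (ψ ∘ φ.symm)
      (((ContinuousLinearMap.toSpanSingleton ℂ
        (deriv (ψ ∘ φ.symm) z)).restrictScalars ℝ : ℂ →L[ℝ] ℂ)) (φ '' E) z := by
    rintro _ ⟨p, hp, rfl⟩
    exact ((hasDerivAt_transition hφ hψ
      ⟨hEφ hp, hEψ hp⟩).hasFDerivAt.restrictScalars ℝ).hasFDerivWithinAt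
  rw [himg, lintegral_image_eq_lintegral_abs_det_fderiv_mul volume hmeas hder hinj]
  refine setLIntegral_congr_fun hmeas ?_
  rintro _ ⟨p, hp, rfl⟩
  have hdet : ∀ d : ℂ, ((ContinuousLinearMap.toSpanSingleton ℂ d).restrictScalars ℝ :
      ℂ →L[ℝ] ℂ).det = ‖d‖ ^ 2 := by
    intro d
    rw [← Complex.normSq_eq_norm_sq, ← Algebra.norm_complex_apply, Algebra.norm_apply]
    change LinearMap.det _ = LinearMap.det _
    congr 1
    ext
    simp [mul_comm]
  simp only [Function.comp, φ.left_inv (hEφ hp)]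
  rw [q.compatible φ hφ ψ hψ p ⟨hEφ hp, hEψ hp⟩, hdet, abs_of_nonneg (by positivity), mul_comm,
    enorm_mul, ← norm_pow, ofReal_norm]

theorem chartArea_apply (q : QuadraticDifferential X) (φ : OpenPartialHomeomorph X ℂ)
    {E : Set X} (hE : MeasurableSet E) (hEφ : E ⊆ φ.source) :
    q.chartArea φ E = ∫⁻ z in φ '' E, ‖q.coeff φ z‖ₑ := by
  have hae : AEMeasurable φ.symm
      ((volume.restrict φ.target).withDensity fun z => ‖q.coeff φ z‖ₑ) :=
    (φ.continuousOn_symm.aemeasurable φ.open_target.measurableSet).mono_ac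
      (withDensity_absolutelyContinuous _ _)
  rw [chartArea, Measure.map_apply_of_aemeasurable hae hE, withDensity_apply' _ _,
    Measure.restrict_restrict' φ.open_target.measurableSet,
    φ.image_eq_target_inter_inv_preimage hEφ, inter_comm]

variable [IsManifold 𝓘(ℂ) 1 X] [CompactSpace X] [Nonempty X]

/-- In every chart `φ` of the atlas, the area measure is `|coeff φ| dx dy`. -/
theorem area_apply (q : QuadraticDifferential X) {φ : OpenPartialHomeomorph X ℂ}
    (hφ : φ ∈ atlas ℂ X) {E : Set X} (hE : MeasurableSet E) (hEφ : E ⊆ φ.source) :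
    q.area E = ∫⁻ z in φ '' E, ‖q.coeff φ z‖ₑ := by
  have hD : ∀ n, MeasurableSet (disjointed (fun k => (coverChart X k).source) n) := fun n =>
    MeasurableSet.disjointed (fun k => (coverChart X k).open_source.measurableSet) n
  have hcov : ⋃ n, disjointed (fun k => (coverChart X k).source) n = univ := by
    rw [iUnion_disjointed]
    exact (exists_chart_cover X).choose_spec
  have hterm : ∀ n, (q.chartArea (coverChart X n)).restrict
      (disjointed (fun k => (coverChart X k).source) n) E =
      (q.chartArea φ) (E ∩ disjointed (fun k => (coverChart X k).source) n) := by
    intro n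
    have h1 : E ∩ disjointed (fun k => (coverChart X k).source) n ⊆ (coverChart X n).source :=
      inter_subset_right.trans (disjointed_subset _ n)
    have h2 : E ∩ disjointed (fun k => (coverChart X k).source) n ⊆ φ.source :=
      inter_subset_left.trans hEφ
    rw [Measure.restrict_apply hE, chartArea_apply q _ (hE.inter (hD n)) h1,
      chartArea_apply q _ (hE.inter (hD n)) h2]
    exact lintegral_chart_eq q hφ (chart_mem_atlas ℂ _) (hE.inter (hD n)) h2 h1
  rw [area, Measure.sum_apply _ hE, tsum_congr hterm, ← measure_iUnion _
    (fun n => hE.inter (hD n)), ← inter_iUnion, hcov, inter_univ, chartArea_apply q _ hE hEφ]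
  exact fun i j hij => ((disjoint_disjointed _) hij).mono inter_subset_right inter_subset_right

end Area

end QuadraticDifferential

/-! Fix `s < t` and put `ρ = e^{(t-s)/2}`. A vertical segment of `S_t` is `ρ` times longer when seen
in `X_s`. Whenever it visits `S_s` it follows a vertical line of the buffer `B`, whose height `h` is
at least `α / σ_s`, until it leaves `B` or ends. Mark the segment at spacing `h / 2` as measured in
`X_s`, and also at its far end: every visit continues inside `B` to a marked point. A marked point
has at most two preimages in `B`, and each preimage with a choice of direction accounts for one
parameter interval of length `σ_s / ρ`. So the segment spends time at most `(2ρσ_t/h + 2) · 4σ_s/ρ`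
in `S_s` (`IsVertical.volume_mem_le`).

Integrating over the width of `S_t` gives `|A_s ∩ A_t| ≤ (8/α) σ_s² σ_t² + 8 σ_s σ_t e^{-(t-s)/2}`
(`area_pullback_inter_le`). The first term has the desired form because flat embedded squares have
area `σ²` (`IsFlat.area_image`). The second is an end effect, and it is harmless once `t - s ≥ 2 log
t`: then `e^{-(t-s)/2} ≤ 1/t ≤ σ_s σ_t / c²`, as `ε ≤ 1`. Times with such gaps can grow as slowly as
`n log n` (`exists_sparse_sequence`). -/

namespace QuadraticDifferential

/-! ### Transition maps between natural parameters -/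

section NaturalParameters

variable {X : Type u} [TopologicalSpace X] [ChartedSpace ℂ X] {q : QuadraticDifferential X}

/-- Two natural parameters differ locally by a map `z ↦ ±z + b`. -/
theorem naturalParameters_transition {ζ₁ ζ₂ : OpenPartialHomeomorph X ℂ}
    (h₁ : ζ₁ ∈ q.naturalParameters) (h₂ : ζ₂ ∈ q.naturalParameters) {p : X}
    (hp₁ : p ∈ ζ₁.source) (hp₂ : p ∈ ζ₂.source) :
    ∃ s b : ℂ, (s = 1 ∨ s = -1) ∧ ∀ᶠ p' in 𝓝 p, ζ₂ p' = s * ζ₁ p' + b := by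
  set φ := chartAt ℂ p with hφ
  have hpφ : p ∈ φ.source := mem_chart_source ℂ p
  have hφa : φ ∈ atlas ℂ X := chart_mem_atlas ℂ p
  have hopen : IsOpen (φ.target ∩ φ.symm ⁻¹' (ζ₁.source ∩ ζ₂.source)) :=
    φ.isOpen_inter_preimage_symm (ζ₁.open_source.inter ζ₂.open_source)
  obtain ⟨r, hr, hball⟩ := Metric.isOpen_iff.1 hopen (φ p)
    ⟨φ.map_source hpφ, by simpa [φ.left_inv hpφ] using ⟨hp₁, hp₂⟩⟩
  set B := Metric.ball (φ p) r
  have key : ∀ ζ ∈ q.naturalParameters, (∀ z ∈ B, φ.symm z ∈ ζ.source) →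
      ∀ z ∈ B, DifferentiableAt ℂ (ζ ∘ φ.symm) z ∧ deriv (ζ ∘ φ.symm) z ^ 2 = q.coeff φ z ∧
        q.coeff φ z ≠ 0 := by
    intro ζ hζ hs z hz
    have hzt := (hball hz).1
    obtain ⟨h0, d, hd, hd2⟩ := hζ (φ.symm z) (hs z hz) φ hφa (φ.map_target hzt)
    rw [φ.right_inv hzt] at h0 hd hd2
    exact ⟨hd.differentiableAt, by rw [hd.deriv, hd2], h0⟩
  have k₁ := key ζ₁ h₁ fun z hz => (hball hz).2.1
  have k₂ := key ζ₂ h₂ fun z hz => (hball hz).2.2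
  have hB : IsOpen B := Metric.isOpen_ball
  have hBc : IsPreconnected B := (convex_ball _ _).isPreconnected
  have hcd : ∀ ζ : OpenPartialHomeomorph X ℂ, (∀ z ∈ B, DifferentiableAt ℂ (ζ ∘ φ.symm) z) →
      ContinuousOn (deriv (ζ ∘ φ.symm)) B := fun ζ h =>
    (DifferentiableOn.deriv (fun z hz => (h z hz).differentiableWithinAt) hB).continuousOn
  -- Both derivatives are continuous square roots of the same nonvanishing function on a ball, so by
  -- connectedness their ratio is a constant sign.
  have hdich : ∃ s : ℂ, (s = 1 ∨ s = -1) ∧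
      ∀ z ∈ B, deriv (ζ₂ ∘ φ.symm) z = s * deriv (ζ₁ ∘ φ.symm) z := by
    rcases hBc.eq_or_eq_neg_of_sq_eq (hcd ζ₂ fun z hz => (k₂ z hz).1)
      (hcd ζ₁ fun z hz => (k₁ z hz).1)
      (fun z hz => by simp [(k₁ z hz).2.1, (k₂ z hz).2.1])
      (fun {z} hz h0 => (k₁ z hz).2.2 (by rw [← (k₁ z hz).2.1, h0]; simp)) with h | h
    · exact ⟨1, Or.inl rfl, fun z hz => by simpa using h hz⟩
    · exact ⟨-1, Or.inr rfl, fun z hz => by simpa using h hz⟩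
  obtain ⟨s, hs, hder⟩ := hdich
  obtain ⟨b, hb⟩ := hB.exists_is_const_of_deriv_eq_zero hBc
    (f := fun z => (ζ₂ ∘ φ.symm) z - s * (ζ₁ ∘ φ.symm) z)
    (fun z hz => ((k₂ z hz).1.sub ((k₁ z hz).1.const_mul s)).differentiableWithinAt)
    (fun z hz => by
      have := ((k₂ z hz).1.hasDerivAt.sub ((k₁ z hz).1.hasDerivAt.const_mul s)).deriv
      rw [hder z hz, sub_self] at this
      exact this)
  refine ⟨s, b, hs, ?_⟩
  have hcont : ∀ᶠ p' in 𝓝 p, φ p' ∈ B :=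
    (φ.continuousAt hpφ).eventually (hB.mem_nhds (Metric.mem_ball_self hr))
  filter_upwards [hcont, φ.open_source.mem_nhds hpφ] with p' hp' hp's
  have := hb _ hp'
  simp only [Function.comp, φ.left_inv hp's] at this
  rw [← this]; ring

end NaturalParameters

/-! ### Vertical curves and unique continuation -/

section Vertical

variable {X : Type u} [TopologicalSpace X] [ChartedSpace ℂ X] (q : QuadraticDifferential X)

/-- `γ` runs on `J` along the vertical foliation of `q`, at constant speed `κ`. -/
def IsVertical (κ : ℝ) (γ : ℝ → X) (J : Set ℝ) : Prop :=
  ∀ v ∈ J, ∃ ζ ∈ q.naturalParameters, ∃ s b : ℂ, (s = 1 ∨ s = -1) ∧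
    ∀ᶠ u : ℝ in 𝓝[J] v, γ u ∈ ζ.source ∧ ζ (γ u) = s * (κ * u * Complex.I) + b

variable {q} {κ : ℝ} {γ β : ℝ → X} {I J : Set ℝ}

theorem IsVertical.continuousOn (h : q.IsVertical κ γ J) : ContinuousOn γ J := by
  intro v hv
  obtain ⟨ζ, -, s, b, -, he⟩ := h v hv
  have hv' := he.self_of_nhdsWithin hv
  have h1 : Tendsto (fun u : ℝ => ζ.symm (s * (κ * u * Complex.I) + b)) (𝓝[J] v)
      (𝓝 (γ v)) := by
    have h2 : ContinuousAt ζ.symm (s * (κ * v * Complex.I) + b) := by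
      rw [← hv'.2]; exact ζ.continuousAt_symm (ζ.map_source hv'.1)
    have h3 : ContinuousAt (fun u : ℝ => s * (κ * u * Complex.I) + b) v := by fun_prop
    have h4 := ContinuousAt.comp (f := fun u : ℝ => s * (κ * u * Complex.I) + b) h2 h3
    have h5 : γ v = ζ.symm (s * (κ * v * Complex.I) + b) := by
      rw [← hv'.2, ζ.left_inv hv'.1]
    rw [h5]
    exact h4.tendsto.mono_left nhdsWithin_le_nhds
  refine h1.congr' ?_
  filter_upwards [he] with u hu
  rw [← hu.2, ζ.left_inv hu.1]

theorem IsVertical.mono (h : q.IsVertical κ γ J) (hI : I ⊆ J) : q.IsVertical κ γ I := by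
  intro v hv
  obtain ⟨ζ, hζ, s, b, hs, he⟩ := h v (hI hv)
  exact ⟨ζ, hζ, s, b, hs, he.filter_mono (nhdsWithin_mono _ hI)⟩

/-- Reparametrizing a vertical curve by an affine map. -/
theorem IsVertical.comp_affine (h : q.IsVertical κ γ J) {ρ κ' : ℝ} (r : ℝ)
    (hκ : κ' = κ * ρ ∨ κ' = -(κ * ρ)) :
    q.IsVertical κ' (fun u => γ (r + ρ * u)) ((fun u => r + ρ * u) ⁻¹' J) := by
  intro v hv
  obtain ⟨ζ, hζ, s, b, hs, he⟩ := h _ hv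
  have hc : Continuous fun u : ℝ => r + ρ * u := by fun_prop
  have ht : Tendsto (fun u : ℝ => r + ρ * u) (𝓝[(fun u => r + ρ * u) ⁻¹' J] v)
      (𝓝[J] (r + ρ * v)) :=
    tendsto_nhdsWithin_iff.2 ⟨hc.continuousAt.tendsto.mono_left nhdsWithin_le_nhds,
      eventually_mem_nhdsWithin⟩
  rcases hκ with rfl | rfl
  · refine ⟨ζ, hζ, s, b + s * (κ * r * Complex.I), hs, (ht.eventually he).mono
      fun u hu => ⟨hu.1, ?_⟩⟩
    rw [hu.2]; push_cast; ring
  -- A reversal of orientation is absorbed in the sign of the natural parameter.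
  · refine ⟨ζ, hζ, -s, b + s * (κ * r * Complex.I), by rcases hs with rfl | rfl <;> simp,
      (ht.eventually he).mono fun u hu => ⟨hu.1, ?_⟩⟩
    rw [hu.2]; push_cast; ring

/-- Two vertical curves meeting at the parameter `v` are given there in one and the same natural
parameter. -/
theorem IsVertical.exists_common (hγ : q.IsVertical κ γ I) (hβ : q.IsVertical κ β J) {v : ℝ}
    (hvI : v ∈ I) (hvJ : v ∈ J) (hv : γ v = β v) :
    ∃ ζ ∈ q.naturalParameters, ∃ s s' b : ℂ, (s = 1 ∨ s = -1) ∧ (s' = s ∨ s' = -s) ∧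
      (∀ᶠ u : ℝ in 𝓝[I] v, γ u ∈ ζ.source ∧ ζ (γ u) = s * (κ * (u - v) * Complex.I) + b) ∧
      ∀ᶠ u : ℝ in 𝓝[J] v, β u ∈ ζ.source ∧ ζ (β u) = s' * (κ * (u - v) * Complex.I) + b := by
  have hβc := hβ.continuousOn v hvJ
  obtain ⟨ζ, hζ, s, b, hs, he⟩ := hγ v hvI
  obtain ⟨ζ', hζ', s', b', hs', he'⟩ := hβ v hvJ
  have h1 := he.self_of_nhdsWithin hvI
  have h2 := he'.self_of_nhdsWithin hvJ
  rw [hv] at h1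
  obtain ⟨e, d, hed, htr⟩ := naturalParameters_transition hζ' hζ h2.1 h1.1
  have h3 := hβc.eventually htr
  have h4 := hβc.eventually (ζ.open_source.mem_nhds h1.1)
  have h5 : ζ (β v) = e * (s' * (κ * v * Complex.I) + b') + d := by
    rw [htr.self_of_nhds, h2.2]
  refine ⟨ζ, hζ, s, e * s', ζ (β v), hs, ?_, ?_, ?_⟩
  · rcases hs with rfl | rfl <;> rcases hs' with rfl | rfl <;> rcases hed with rfl | rfl <;> simp
  · filter_upwards [he] with u hu
    refine ⟨hu.1, ?_⟩
    rw [hu.2, h1.2]; ring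
  · filter_upwards [h3, h4, he'] with u hu3 hu4 hu
    refine ⟨hu4, ?_⟩
    rw [hu3, hu.2, h5]; ring

/-- Vertical curves on an interval that agree near one parameter agree. -/
theorem IsVertical.eqOn [T2Space X] (hκ : κ ≠ 0) (hJ : J.OrdConnected) (hγ : q.IsVertical κ γ J)
    (hβ : q.IsVertical κ β J) {v : ℝ} (hv : v ∈ J) (h : γ =ᶠ[𝓝[J] v] β) : EqOn γ β J := by
  -- Agreement of germs is a locally constant property of the parameter, hence constant on the
  -- interval. Where the germs differ, the curves are apart at all nearby parameters other than `x`.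
  have main : ∀ x ∈ J, ∀ᶠ y in 𝓝[J] x, (γ =ᶠ[𝓝[J] x] β ↔ γ =ᶠ[𝓝[J] y] β) := by
    intro x hx
    by_cases hQ : γ =ᶠ[𝓝[J] x] β
    · filter_upwards [eventually_eventually_nhdsWithin.2 hQ] with y hy
      exact iff_of_true hQ hy
    have hno : ∀ᶠ y in 𝓝[J] x, y = x ∨ γ y ≠ β y := by
      by_cases hxe : γ x = β x
      · obtain ⟨ζ, -, s, s', b, hs, hs', e1, e2⟩ := hγ.exists_common hβ hx hx hxe
        rcases hs' with rfl | rfl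
        · refine absurd ?_ hQ
          filter_upwards [e1, e2] with u h1 h2
          exact ζ.injOn h1.1 h2.1 (h1.2.trans h2.2.symm)
        -- Here the curves run through the common point in opposite directions; as `κ ≠ 0`, they
        -- agree only at `u = x`.
        · filter_upwards [e1, e2] with u h1 h2
          by_contra! hcon
          have h3 := h1.2.symm.trans ((congrArg ζ hcon.2).trans h2.2)
          have h4 : s * (κ * (u - x) * Complex.I) = 0 := by linear_combination h3 / 2
          have hs0 : s ≠ 0 := by rcases hs with rfl | rfl <;> simp
          have hκ' : (κ : ℂ) ≠ 0 := by exact_mod_cast hκ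
          simp [hs0, hκ', sub_eq_zero] at h4
          exact hcon.1 h4
      · filter_upwards [((hγ.continuousOn x hx).prodMk (hβ.continuousOn x hx)).eventually
          (isOpen_ne_fun continuous_fst continuous_snd |>.mem_nhds hxe)] with y hy
        exact Or.inr hy
    filter_upwards [hno, self_mem_nhdsWithin] with y hy hyJ
    rcases hy with rfl | hy
    · rfl
    · exact iff_of_false hQ fun h' => hy (h'.self_of_nhdsWithin hyJ)
  intro x hx
  have hx' := hJ.isPreconnected.induction₂ (fun x y => (γ =ᶠ[𝓝[J] x] β ↔ γ =ᶠ[𝓝[J] y] β)) main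
    (fun x y z _ _ _ h1 h2 => h1.trans h2) (fun x y _ _ h => h.symm) hv hx
  exact (hx'.1 h).self_of_nhdsWithin hx

end Vertical

end QuadraticDifferential

/-! ### Time spent by a vertical curve in a buffered rectangle -/

/-- An interval `K` that contains an open interval of length `2 * δ` and meets `[a, b]` contains `b`
or a point of the grid of mesh `δ` that starts at `a`. -/
theorem Set.OrdConnected.exists_grid_mem {K : Set ℝ} (hK : K.OrdConnected) {a b y y₁ y₂ δ : ℝ}
    (hδ : 0 < δ) (hlen : y₂ - y₁ = 2 * δ) (hsub : Ioo y₁ y₂ ⊆ K) (hy : y ∈ K)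
    (hyab : y ∈ Icc a b) :
    ∃ u ∈ Icc a b, u ∈ K ∧ (u = b ∨ ∃ k : ℕ, k ≤ ⌊(b - a) / δ⌋₊ ∧ u = a + k * δ) := by
  have hab : a ≤ b := hyab.1.trans hyab.2
  by_cases ha : a ∈ K
  · exact ⟨a, left_mem_Icc.2 hab, ha, Or.inr ⟨0, Nat.zero_le _, by simp⟩⟩
  by_cases hb : b ∈ K
  · exact ⟨b, right_mem_Icc.2 hab, hb, Or.inl rfl⟩
  have hmid : (y₁ + y₂) / 2 ∈ K := hsub ⟨by linarith, by linarith⟩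
  -- Since `K` is an interval that meets `[a, b]` but omits both endpoints, the open interval of
  -- length `2 * δ` lies between them.
  have h1 : a ≤ y₁ := by
    by_contra! hlt
    rcases lt_or_ge a y₂ with h | h
    · exact ha (hsub ⟨hlt, h⟩)
    · exact ha (hK.out hmid hy ⟨by linarith, hyab.1⟩)
  have h2 : y₂ ≤ b := by
    by_contra! hlt
    rcases lt_or_ge y₁ b with h | h
    · exact hb (hsub ⟨h, hlt⟩)
    · exact hb (hK.out hy hmid ⟨hyab.2, by linarith⟩)
  have h3 : 0 ≤ (y₁ - a) / δ := div_nonneg (by linarith) hδ.le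
  have h4 := Nat.lt_floor_add_one ((y₁ - a) / δ)
  have h5 := Nat.floor_le h3
  rw [div_lt_iff₀ hδ] at h4
  rw [le_div_iff₀ hδ] at h5
  -- The first grid point strictly beyond `y₁` is at most `y₁ + δ`, hence before `y₂`.
  have h6 : a + ((⌊(y₁ - a) / δ⌋₊ + 1 : ℕ) : ℝ) * δ < y₂ ∧
      y₁ < a + ((⌊(y₁ - a) / δ⌋₊ + 1 : ℕ) : ℝ) * δ := by
    push_cast
    constructor <;> nlinarith
  refine ⟨_, ⟨by linarith, by linarith⟩, hsub ⟨h6.2, h6.1⟩, Or.inr ⟨_, ?_, rfl⟩⟩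
  refine Nat.le_floor ?_
  rw [le_div_iff₀ hδ]
  linarith

namespace QuadraticDifferential

variable {X : Type u} [TopologicalSpace X] [ChartedSpace ℂ X] {q : QuadraticDifferential X}

/-- Two vertical curves that meet coincide up to a reflection of the parameter. -/
theorem IsVertical.eq_or_eq_reflect [T2Space X] {κ : ℝ} {γ β : ℝ → X} {I J : Set ℝ} (hκ : κ ≠ 0)
    (hI : I.OrdConnected) (hJ : J.OrdConnected) (hγ : q.IsVertical κ γ I)
    (hβ : q.IsVertical κ β J) {v : ℝ} (hvI : v ∈ I) (hvJ : v ∈ J) (h : γ v = β v) :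
    (∀ u ∈ I, u ∈ J → γ u = β u) ∨ ∀ u ∈ I, 2 * v - u ∈ J → γ u = β (2 * v - u) := by
  obtain ⟨ζ, -, s, s', b, -, hs', e1, e2⟩ := hγ.exists_common hβ hvI hvJ h
  rcases hs' with rfl | rfl
  · refine Or.inl fun u hu hu' => (hγ.mono inter_subset_left).eqOn hκ (hI.inter hJ)
      (hβ.mono inter_subset_right) ⟨hvI, hvJ⟩ ?_ ⟨hu, hu'⟩
    filter_upwards [e1.filter_mono (nhdsWithin_mono _ inter_subset_left),
      e2.filter_mono (nhdsWithin_mono _ inter_subset_right)] with u h1 h2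
    exact ζ.injOn h1.1 h2.1 (h1.2.trans h2.2.symm)
  · right
    -- When the directions are opposite, unique continuation applies to `γ` and the reflection of
    -- `β` about `v`.
    set J' : Set ℝ := (fun u => 2 * v + (-1) * u) ⁻¹' J with hJ'
    have hβ' : q.IsVertical κ (fun u => β (2 * v + (-1) * u)) J' :=
      hβ.comp_affine (2 * v) (Or.inr (by ring))
    have hJ'o : J'.OrdConnected := hJ.preimage_anti fun x y hxy => by
      have : (2 * v + (-1) * y : ℝ) ≤ 2 * v + (-1) * x := by linarith
      exact this
    have hvJ' : v ∈ J' := by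
      rw [hJ', mem_preimage]; convert hvJ using 1; ring
    have ht : Tendsto (fun u : ℝ => 2 * v + (-1) * u) (𝓝[J'] v) (𝓝[J] v) := by
      refine tendsto_nhdsWithin_iff.2 ⟨?_, eventually_mem_nhdsWithin⟩
      have hc : Continuous fun u : ℝ => 2 * v + (-1) * u := by fun_prop
      have := hc.tendsto v
      rw [show 2 * v + (-1) * v = v by ring] at this
      exact this.mono_left nhdsWithin_le_nhds
    intro u hu hu'
    have := (hγ.mono inter_subset_left).eqOn hκ (hI.inter hJ'o)
      (hβ'.mono inter_subset_right) ⟨hvI, hvJ'⟩ ?_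
      ⟨hu, by rw [hJ', mem_preimage]; convert hu' using 1; ring⟩
    · exact this.trans (congrArg β (by ring))
    filter_upwards [e1.filter_mono (nhdsWithin_mono _ inter_subset_left),
      (ht.eventually e2).filter_mono (nhdsWithin_mono _ inter_subset_right)] with u h1 h2
    refine ζ.injOn h1.1 h2.1 (h1.2.trans (h2.2.trans ?_).symm)
    push_cast; ring

/-- The parameters of a vertical curve whose position at the parameter `u` lies, at vertical
distance `ρ * |u - y|`, in a strip `c ≤ Im ≤ d`. -/
theorem volume_crossing_le {Y : Type*} {g : ℂ → Y} {D : Set ℂ} {p : Y}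
    (hfib : {z | z ∈ D ∧ g z = p}.encard ≤ 2) {ρ c d : ℝ} (hρ : 0 < ρ) (u : ℝ) :
    volume {y : ℝ | ∃ e : ℝ, (e = 1 ∨ e = -1) ∧ ∃ w ∈ D, g w = p ∧
      w.im - e * ρ * (u - y) ∈ Icc c d} ≤ ENNReal.ofReal (4 * ((d - c) / ρ)) := by
  rcases lt_or_ge d c with hcd | hcd
  · simp [Icc_eq_empty_of_lt hcd]
  have hfin : {z | z ∈ D ∧ g z = p}.Finite := finite_of_encard_le_coe hfib
  have hcard : hfin.toFinset.card ≤ 2 := by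
    rw [hfin.encard_eq_coe_toFinset_card] at hfib
    exact_mod_cast hfib
  have hnn : 0 ≤ (d - c) / ρ := div_nonneg (by linarith) hρ.le
  -- For a fixed preimage `w` and direction `e`, the condition confines `y` to an interval of length
  -- `(d - c) / ρ`. Two directions and at most two preimages give the factor 4.
  have hsub : {y : ℝ | ∃ e : ℝ, (e = 1 ∨ e = -1) ∧ ∃ w ∈ D, g w = p ∧
      w.im - e * ρ * (u - y) ∈ Icc c d} ⊆ ⋃ w ∈ hfin.toFinset,
        (Icc (u + (c - w.im) / ρ) (u + (d - w.im) / ρ) ∪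
          Icc (u - (d - w.im) / ρ) (u - (c - w.im) / ρ)) := by
    rintro y ⟨e, he, w, hw, hg, h1, h2⟩
    refine mem_iUnion₂.2 ⟨w, by simpa using ⟨hw, hg⟩, ?_⟩
    rcases he with rfl | rfl
    · left
      rw [mem_Icc, ← sub_nonneg, ← sub_nonneg (b := y)]
      constructor
      · rw [show y - (u + (c - w.im) / ρ) = (w.im - 1 * ρ * (u - y) - c) / ρ by field_simp; ring]
        exact div_nonneg (by linarith) hρ.le
      · rw [show (u + (d - w.im) / ρ) - y = (d - (w.im - 1 * ρ * (u - y))) / ρ by field_simp; ring]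
        exact div_nonneg (by linarith) hρ.le
    · right
      rw [mem_Icc, ← sub_nonneg, ← sub_nonneg (b := y)]
      constructor
      · rw [show y - (u - (d - w.im) / ρ) = (d - (w.im - -1 * ρ * (u - y))) / ρ by field_simp; ring]
        exact div_nonneg (by linarith) hρ.le
      · rw [show (u - (c - w.im) / ρ) - y = (w.im - -1 * ρ * (u - y) - c) / ρ by field_simp; ring]
        exact div_nonneg (by linarith) hρ.le
  refine (measure_mono hsub).trans ((measure_biUnion_finset_le _ _).trans ?_)
  refine (Finset.sum_le_card_nsmul _ _ (ENNReal.ofReal (2 * ((d - c) / ρ))) fun w _ => ?_).trans ?_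
  · refine (measure_union_le _ _).trans ?_
    rw [Real.volume_Icc, Real.volume_Icc, ← ENNReal.ofReal_add]
    · refine ENNReal.ofReal_le_ofReal (le_of_eq ?_)
      field_simp; ring
    · rw [show u + (d - w.im) / ρ - (u + (c - w.im) / ρ) = (d - c) / ρ by field_simp; ring]
      exact hnn
    · rw [show u - (c - w.im) / ρ - (u - (d - w.im) / ρ) = (d - c) / ρ by field_simp; ring]
      exact hnn
  · rw [nsmul_eq_mul]
    refine (mul_le_mul_left (Nat.cast_le.2 hcard) _).trans ?_
    rw [show ((2 : ℕ) : ℝ≥0∞) = ENNReal.ofReal 2 by simp, ← ENNReal.ofReal_mul (by norm_num)]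
    exact ENNReal.ofReal_le_ofReal (by linarith)

/-- A vertical curve over a compact interval spends little time in a rectangle that
extends vertically to a tall rectangle with at most double overlap. -/
theorem IsVertical.volume_mem_le [T2Space X] {κ κ' ρ : ℝ} (hκ : κ ≠ 0) (hρ : 0 < ρ)
    (hκρ : κ = κ' * ρ) {f : ℝ → X} {a b : ℝ} (hf : q.IsVertical κ f (Icc a b)) {g : ℂ → X}
    {H J J' : Set ℝ} (hJ : J.OrdConnected) (hg : ∀ x ∈ H, q.IsVertical κ' (fun r => g ⟨x, r⟩) J)
    (hfib : ∀ p : X, {z | z ∈ H ×ℂ J ∧ g z = p}.encard ≤ 2) {l h : ℝ} (hh : 0 < h)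
    (hlJ : Ioo l (l + h) ⊆ J) {c d : ℝ} (hJ' : J' ⊆ J) (hcd : J' ⊆ Icc c d) :
    volume {y | y ∈ Icc a b ∧ ∃ z ∈ H ×ℂ J', g z = f y} ≤
      ENNReal.ofReal ((2 * ρ * (b - a) / h + 2) * (4 * ((d - c) / ρ))) := by
  rcases eq_empty_or_nonempty {y | y ∈ Icc a b ∧ ∃ z ∈ H ×ℂ J', g z = f y} with he | ⟨y₀, hy₀⟩
  · rw [he]; simp
  have hab : a ≤ b := hy₀.1.1.trans hy₀.1.2
  have hcd0 : c ≤ d := by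
    obtain ⟨-, z, hz, -⟩ := hy₀
    exact (hcd hz.2).1.trans (hcd hz.2).2
  -- Half the parameter time needed to cross height `h`, as `exists_grid_mem` requires.
  set δ : ℝ := h / (2 * ρ) with hδdef
  have hδ : 0 < δ := by positivity
  set N : ℝ → Set ℝ := fun u => {y : ℝ | ∃ e : ℝ, (e = 1 ∨ e = -1) ∧ ∃ w ∈ H ×ℂ J, g w = f u ∧
      w.im - e * ρ * (u - y) ∈ Icc c d} with hN
  -- After a visit at `y`, the curve follows the vertical line through `z` in direction `e` as long
  -- as the height stays in `J`.
  have hcont : ∀ y ∈ Icc a b, ∀ z ∈ H ×ℂ J', g z = f y → ∃ e : ℝ, (e = 1 ∨ e = -1) ∧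
      ∀ u ∈ Icc a b, z.im + e * ρ * (u - y) ∈ J → g ⟨z.re, z.im + e * ρ * (u - y)⟩ = f u := by
    intro y hy z hz hgz
    have hβ := (hg z.re hz.1).comp_affine (z.im - ρ * y) (Or.inl hκρ)
    have hyy : z.im - ρ * y + ρ * y = z.im := by ring
    have hord : ((fun u : ℝ => z.im - ρ * y + ρ * u) ⁻¹' J).OrdConnected :=
      hJ.preimage_mono fun u v huv => by
        have := mul_le_mul_of_nonneg_left huv hρ.le
        simpa using this
    rcases hf.eq_or_eq_reflect hκ ordConnected_Icc hord hβ hy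
      (by rw [mem_preimage, hyy]; exact hJ' hz.2) (by rw [hyy]; exact hgz.symm) with h1 | h1
    · refine ⟨1, Or.inl rfl, fun u hu huJ => ?_⟩
      rw [h1 u hu (by rw [mem_preimage]; convert huJ using 1; ring)]
      congr 2; ring
    · refine ⟨-1, Or.inr rfl, fun u hu huJ => ?_⟩
      rw [h1 u hu (by rw [mem_preimage]; convert huJ using 1; ring)]
      congr 2; ring
  -- Every visit is charged to a grid point or to `b`. The `+ 2` in the bound counts the grid point
  -- at `a` and the endpoint `b`.
  have hcover : {y | y ∈ Icc a b ∧ ∃ z ∈ H ×ℂ J', g z = f y} ⊆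
      N b ∪ ⋃ k ∈ Finset.range (⌊(b - a) / δ⌋₊ + 1), N (a + k * δ) := by
    rintro y ⟨hy, z, hz, hgz⟩
    obtain ⟨e, he, hcon⟩ := hcont y hy z hz hgz
    have hK : ∃ u ∈ Icc a b, u ∈ (fun u : ℝ => z.im + e * ρ * (u - y)) ⁻¹' J ∧
        (u = b ∨ ∃ k : ℕ, k ≤ ⌊(b - a) / δ⌋₊ ∧ u = a + k * δ) := by
      have hyK : y ∈ (fun u : ℝ => z.im + e * ρ * (u - y)) ⁻¹' J := by
        simpa using hJ' hz.2
      rcases he with rfl | rfl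
      · refine Set.OrdConnected.exists_grid_mem (y₁ := y + (l - z.im) / ρ)
          (y₂ := y + (l + h - z.im) / ρ) ?_ hδ (by rw [hδdef]; field_simp; ring) ?_ hyK hy
        · exact hJ.preimage_mono fun u v huv => by
            have := mul_le_mul_of_nonneg_left huv hρ.le
            linarith
        · rintro u ⟨hu1, hu2⟩
          rw [← sub_lt_iff_lt_add', lt_div_iff₀ hρ] at hu2
          rw [← lt_sub_iff_add_lt', div_lt_iff₀ hρ] at hu1
          exact hlJ ⟨by linarith, by linarith⟩
      · refine Set.OrdConnected.exists_grid_mem (y₁ := y - (l + h - z.im) / ρ)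
          (y₂ := y - (l - z.im) / ρ) ?_ hδ (by rw [hδdef]; field_simp; ring) ?_ hyK hy
        · exact hJ.preimage_anti fun u v huv => by
            have := mul_le_mul_of_nonneg_left huv hρ.le
            linarith
        · rintro u ⟨hu1, hu2⟩
          rw [sub_lt_comm, lt_div_iff₀ hρ] at hu1
          rw [lt_sub_comm, div_lt_iff₀ hρ] at hu2
          exact hlJ ⟨by linarith, by linarith⟩
    obtain ⟨u, hu, huK, hgrid⟩ := hK
    have hyN : y ∈ N u := by
      refine ⟨e, he, ⟨z.re, z.im + e * ρ * (u - y)⟩, ⟨hz.1, huK⟩, hcon u hu huK, ?_⟩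
      have : z.im + e * ρ * (u - y) - e * ρ * (u - y) = z.im := by ring
      simp only [this]
      exact hcd hz.2
    rcases hgrid with rfl | ⟨k, hk, rfl⟩
    · exact Or.inl hyN
    · exact Or.inr (mem_iUnion₂.2 ⟨k, Finset.mem_range.2 (Nat.lt_succ_of_le hk), hyN⟩)
  have hNle : ∀ u, volume (N u) ≤ ENNReal.ofReal (4 * ((d - c) / ρ)) := fun u =>
    volume_crossing_le (hfib (f u)) hρ u
  refine (measure_mono hcover).trans ((measure_union_le _ _).trans ?_)
  refine (add_le_add (hNle b) ((measure_biUnion_finset_le _ _).trans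
    (Finset.sum_le_card_nsmul _ _ _ fun k _ => hNle _))).trans ?_
  rw [Finset.card_range, nsmul_eq_mul, ← one_add_mul,
    ENNReal.ofReal_mul (p := 2 * ρ * (b - a) / h + 2)
      (add_nonneg (div_nonneg (mul_nonneg (by positivity) (by linarith)) hh.le) (by norm_num))]
  refine mul_le_mul_left ?_ _
  rw [show (1 : ℝ≥0∞) + ((⌊(b - a) / δ⌋₊ + 1 : ℕ) : ℝ≥0∞) =
    ENNReal.ofReal (⌊(b - a) / δ⌋₊ + 2 : ℝ) by
      rw [← ENNReal.ofReal_natCast, ← ENNReal.ofReal_one,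
        ← ENNReal.ofReal_add (by norm_num) (by positivity)]
      push_cast; congr 1; ring]
  refine ENNReal.ofReal_le_ofReal (add_le_add ?_ le_rfl)
  refine (Nat.floor_le (div_nonneg (by linarith) hδ.le)).trans (le_of_eq ?_)
  rw [hδdef]; field_simp

/-- The version of `IsVertical.volume_mem_le` for an open interval. -/
theorem IsVertical.volume_mem_Ioo_le [T2Space X] {κ κ' ρ : ℝ} (hκ : κ ≠ 0) (hρ : 0 < ρ)
    (hκρ : κ = κ' * ρ) {f : ℝ → X} {a b : ℝ} (hf : q.IsVertical κ f (Ioo a b)) {g : ℂ → X}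
    {H J J' : Set ℝ} (hJ : J.OrdConnected) (hg : ∀ x ∈ H, q.IsVertical κ' (fun r => g ⟨x, r⟩) J)
    (hfib : ∀ p : X, {z | z ∈ H ×ℂ J ∧ g z = p}.encard ≤ 2) {l h : ℝ} (hh : 0 < h)
    (hlJ : Ioo l (l + h) ⊆ J) {c d : ℝ} (hc : c ≤ d) (hJ' : J' ⊆ J) (hcd : J' ⊆ Icc c d) :
    volume {y | y ∈ Ioo a b ∧ ∃ z ∈ H ×ℂ J', g z = f y} ≤
      ENNReal.ofReal ((2 * ρ * (b - a) / h + 2) * (4 * ((d - c) / ρ))) := by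
  set E : ℕ → Set ℝ := fun n => {y | y ∈ Icc (a + 1 / ((n : ℝ) + 1)) (b - 1 / ((n : ℝ) + 1)) ∧
    ∃ z ∈ H ×ℂ J', g z = f y} with hE
  have hmono : Monotone E := fun n m hnm y hy => by
    have := Nat.one_div_le_one_div (α := ℝ) hnm
    exact ⟨⟨by linarith [hy.1.1], by linarith [hy.1.2]⟩, hy.2⟩
  have hsub : {y | y ∈ Ioo a b ∧ ∃ z ∈ H ×ℂ J', g z = f y} ⊆ ⋃ n, E n := by
    rintro y ⟨hy, hz⟩
    obtain ⟨n, hn⟩ := exists_nat_one_div_lt (lt_min (sub_pos.2 hy.1) (sub_pos.2 hy.2))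
    rw [lt_min_iff] at hn
    exact mem_iUnion.2 ⟨n, ⟨⟨by linarith, by linarith⟩, hz⟩⟩
  refine (measure_mono hsub).trans ?_
  rw [hmono.measure_iUnion]
  refine iSup_le fun n => ?_
  have hpos : 0 < 1 / ((n : ℝ) + 1) := by positivity
  refine (IsVertical.volume_mem_le hκ hρ hκρ (hf.mono ?_) hJ hg hfib hh hlJ hJ' hcd).trans ?_
  · exact fun y hy => ⟨by linarith [hy.1], by linarith [hy.2]⟩
  · refine ENNReal.ofReal_le_ofReal (mul_le_mul_of_nonneg_right ?_ ?_)
    · gcongr <;> linarith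
    · exact mul_nonneg (by norm_num) (div_nonneg (by linarith) hρ.le)

end QuadraticDifferential

/-! ### Area and flat maps -/

/-- The linear map underlying `teichmullerLinear t` preserves Lebesgue measure. -/
theorem measurePreserving_teichmullerLinear (t : ℝ) :
    MeasurePreserving (teichmullerLinear t) volume volume := by
  have h1 : ∀ r : ℝ, r ≠ 0 → Measure.map (r * ·) (volume : Measure ℝ) =
      ENNReal.ofReal |r⁻¹| • volume := fun r hr => Real.map_volume_mul_left hr
  have h2 : MeasurePreserving (fun p : ℝ × ℝ => (Real.exp (t / 2) * p.1, Real.exp (-t / 2) * p.2))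
      volume volume := by
    refine ⟨by fun_prop, ?_⟩
    change Measure.map (Prod.map (Real.exp (t / 2) * ·) (Real.exp (-t / 2) * ·))
      ((volume : Measure ℝ).prod volume) = _
    rw [← Measure.map_prod_map _ _ (by fun_prop) (by fun_prop), h1 _ (Real.exp_pos _).ne',
      h1 _ (Real.exp_pos _).ne', Measure.prod_smul_left, Measure.prod_smul_right, smul_smul,
      ← ENNReal.ofReal_mul (abs_nonneg _), ← abs_mul, ← mul_inv, ← Real.exp_add,
      show t / 2 + -t / 2 = 0 by ring]
    simp [Measure.volume_eq_prod]
  exact (Complex.volume_preserving_equiv_real_prod.symm.comp h2).comp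
    Complex.volume_preserving_equiv_real_prod

/-- Affine coordinate changes `z ↦ ±z + b` preserve Lebesgue measure. -/
theorem volume_image_affine {s : ℂ} (hs : s = 1 ∨ s = -1) (b : ℂ) (D : Set ℂ) :
    volume ((fun w => s * w + b) '' D) = volume D := by
  have : (fun w => s * w + b) '' D = (· + b) '' ((s * ·) '' D) := by rw [image_image]
  rw [this, image_add_right, measure_preimage_add_right]
  rcases hs with rfl | rfl
  · simp
  · simp

theorem ContinuousOn.measurableSet_inter_preimage {α β : Type*} [TopologicalSpace α]
    [MeasurableSpace α] [OpensMeasurableSpace α] [TopologicalSpace β] [MeasurableSpace β]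
    [BorelSpace β] {f : α → β} {s : Set α} {t : Set β} (hf : ContinuousOn f s)
    (hs : MeasurableSet s) (ht : MeasurableSet t) : MeasurableSet (s ∩ f ⁻¹' t) := by
  have h1 : Measurable (s.domRestrict f) := (continuousOn_iff_continuous_domRestrict.1 hf).measurable
  convert hs.subtype_image (h1 ht) using 1
  ext z
  simp [and_comm]

theorem teichmullerLinear_symm_apply (t : ℝ) (w : ℂ) : (teichmullerLinear t).symm w =
    ⟨Real.exp (-t / 2) * w.re, Real.exp (t / 2) * w.im⟩ := rfl

namespace QuadraticDifferential

variable {X : Type u} [TopologicalSpace X] [ChartedSpace ℂ X]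

section Area

variable {q : QuadraticDifferential X} [MeasurableSpace X] [BorelSpace X]
  [IsManifold 𝓘(ℂ) 1 X] [CompactSpace X] [Nonempty X]

/-- In a natural parameter the area measure is Lebesgue measure. -/
theorem area_eq_volume_image {ζ : OpenPartialHomeomorph X ℂ} (hζ : ζ ∈ q.naturalParameters)
    {φ : OpenPartialHomeomorph X ℂ} (hφ : φ ∈ atlas ℂ X) {E : Set X} (hE : MeasurableSet E)
    (hEφ : E ⊆ φ.source) (hEζ : E ⊆ ζ.source) : q.area E = volume (ζ '' E) := by
  rw [area_apply q hφ hE hEφ]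
  have himg : ζ '' E = (ζ ∘ φ.symm) '' (φ '' E) := by
    rw [image_image]
    refine image_congr fun p hp => ?_
    simp [φ.left_inv (hEφ hp)]
  have hinj : InjOn (ζ ∘ φ.symm) (φ '' E) := by
    rintro _ ⟨p, hp, rfl⟩ _ ⟨p', hp', rfl⟩ h
    simp only [Function.comp, φ.left_inv (hEφ hp), φ.left_inv (hEφ hp')] at h
    rw [ζ.injOn (hEζ hp) (hEζ hp') h]
  have hmeas := measurableSet_chart_image φ hE hEφ
  have hd : ∀ z ∈ φ '' E, HasDerivAt (ζ ∘ φ.symm) (deriv (ζ ∘ φ.symm) z) z ∧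
      deriv (ζ ∘ φ.symm) z ^ 2 = q.coeff φ z := by
    rintro _ ⟨p, hp, rfl⟩
    obtain ⟨-, d, hd, hd2⟩ := hζ p (hEζ hp) φ hφ (hEφ hp)
    exact ⟨hd.differentiableAt.hasDerivAt, by rw [hd.deriv, hd2]⟩
  have hder : ∀ z ∈ φ '' E, HasFDerivWithinAt (ζ ∘ φ.symm)
      (((ContinuousLinearMap.toSpanSingleton ℂ
        (deriv (ζ ∘ φ.symm) z)).restrictScalars ℝ : ℂ →L[ℝ] ℂ)) (φ '' E) z := fun z hz =>
    ((hd z hz).1.hasFDerivAt.restrictScalars ℝ).hasFDerivWithinAt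
  rw [himg, ← lintegral_abs_det_fderiv_eq_addHaar_image volume hmeas hder hinj]
  refine setLIntegral_congr_fun hmeas fun z hz => ?_
  have hdet : ∀ d : ℂ, ((ContinuousLinearMap.toSpanSingleton ℂ d).restrictScalars ℝ :
      ℂ →L[ℝ] ℂ).det = ‖d‖ ^ 2 := by
    -- The real determinant of multiplication by `d` is the algebra norm of `d` over `ℝ`, which is
    -- `‖d‖ ^ 2`.
    intro d
    rw [← Complex.normSq_eq_norm_sq, ← Algebra.norm_complex_apply, Algebra.norm_apply]
    change LinearMap.det _ = LinearMap.det _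
    congr 1
    ext
    simp [mul_comm]
  rw [← (hd z hz).2, hdet, abs_of_nonneg (by positivity), ← norm_pow, ofReal_norm]

end Area

section Flat

variable (q : QuadraticDifferential X)

/-- `f` reads `z ↦ ±z + b` in natural parameters of `X_t`, locally on `D`. -/
def IsFlat (t : ℝ) (f : ℂ → X) (D : Set ℂ) : Prop :=
  ∀ z ∈ D, ∃ ζ ∈ q.naturalParameters, ∃ s b : ℂ, (s = 1 ∨ s = -1) ∧
    ∀ᶠ w in 𝓝[D] z, f w ∈ ζ.source ∧ teichmullerLinear t (ζ (f w)) = s * w + b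

variable {q} {t : ℝ}

/-- The underlying map into `X` of a map into `X_t`. -/
def toBase (R : RectangleMap (q.FlowSurface t)) (z : ℂ) : X := R.toFun z

theorem IsRectangle.isFlat {R : RectangleMap (q.FlowSurface t)} (h : q.IsRectangle t R) :
    q.IsFlat t (toBase R) R.domain := by
  intro z hz
  obtain ⟨ξ, ⟨ζ, hζ, rfl⟩, s, b, hs, he⟩ := h z hz
  exact ⟨ζ, hζ, s, b, hs, he.mono fun w hw => ⟨hw.1.2, hw.2⟩⟩

variable {f : ℂ → X} {D : Set ℂ}

/-- Undoing the Teichmüller map stretches heights by `e^{t/2}`, which is therefore the speed in `X`.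
-/
theorem IsFlat.isVertical (h : q.IsFlat t f D) (x : ℝ) {J : Set ℝ}
    (hJ : ∀ u ∈ J, (⟨x, u⟩ : ℂ) ∈ D) :
    q.IsVertical (Real.exp (t / 2)) (fun u => f ⟨x, u⟩) J := by
  intro v hv
  obtain ⟨ζ, hζ, s, b, hs, he⟩ := h _ (hJ v hv)
  have hc : Continuous fun u : ℝ => (⟨x, u⟩ : ℂ) := by
    have : Continuous fun u : ℝ => Complex.equivRealProdCLM.symm (x, u) := by fun_prop
    exact this
  have ht : Tendsto (fun u : ℝ => (⟨x, u⟩ : ℂ)) (𝓝[J] v) (𝓝[D] ⟨x, v⟩) :=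
    tendsto_nhdsWithin_iff.2 ⟨hc.continuousAt.tendsto.mono_left nhdsWithin_le_nhds,
      eventually_mem_nhdsWithin.mono hJ⟩
  refine ⟨ζ, hζ, s, (teichmullerLinear t).symm (s * x + b), hs,
    (ht.eventually he).mono fun u hu => ⟨hu.1, ?_⟩⟩
  rw [← (teichmullerLinear t).symm_apply_apply (ζ (f ⟨x, u⟩)), hu.2,
    teichmullerLinear_symm_apply, teichmullerLinear_symm_apply]
  generalize Real.exp (t / 2) = κ
  rcases hs with rfl | rfl <;> apply Complex.ext <;> simp <;> ring

theorem IsFlat.continuousOn (h : q.IsFlat t f D) : ContinuousOn f D := by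
  intro z hz
  obtain ⟨ζ, -, s, b, -, he⟩ := h z hz
  have hz' := he.self_of_nhdsWithin hz
  have hinv : ∀ w, f w ∈ ζ.source → teichmullerLinear t (ζ (f w)) = s * w + b →
      f w = ζ.symm ((teichmullerLinear t).symm (s * w + b)) := fun w h1 h2 => by
    rw [← h2, Homeomorph.symm_apply_apply, ζ.left_inv h1]
  have h2 : ContinuousAt ζ.symm ((teichmullerLinear t).symm (s * z + b)) := by
    rw [← hz'.2, Homeomorph.symm_apply_apply]
    exact ζ.continuousAt_symm (ζ.map_source hz'.1)
  have h3 : ContinuousAt (fun w : ℂ => (teichmullerLinear t).symm (s * w + b)) z := by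
    have := (teichmullerLinear t).symm.continuous
    exact (this.comp (by fun_prop : Continuous fun w : ℂ => s * w + b)).continuousAt
  have h4 := ContinuousAt.comp (f := fun w : ℂ => (teichmullerLinear t).symm (s * w + b)) h2 h3
  have h5 : Tendsto (fun w : ℂ => ζ.symm ((teichmullerLinear t).symm (s * w + b))) (𝓝[D] z)
      (𝓝 (f z)) := by
    rw [hinv z hz'.1 hz'.2]
    exact h4.tendsto.mono_left nhdsWithin_le_nhds
  exact h5.congr' (he.mono fun w hw => (hinv w hw.1 hw.2).symm)

variable [MeasurableSpace X] [BorelSpace X] [IsManifold 𝓘(ℂ) 1 X] [CompactSpace X] [Nonempty X]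

/-- Near `z` the map is read in one natural parameter as an area-preserving affine map, and one
atlas chart covers the image, so `area_eq_volume_image` applies. `IsFlat.area_image` glues these
local statements. -/
theorem IsFlat.exists_nhds_area_image (h : q.IsFlat t f D) {z : ℂ} (hz : z ∈ D) :
    ∃ U ∈ 𝓝 z, IsOpen U ∧ ∀ D' ⊆ D ∩ U, MeasurableSet D' →
      MeasurableSet (f '' D') ∧ q.area (f '' D') = volume D' := by
  obtain ⟨ζ, hζ, s, b, hs, he⟩ := h z hz
  have hφ := chart_mem_atlas ℂ (f z)
  have he' := (h.continuousOn z hz).eventually (chart_source_mem_nhds ℂ (f z))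
  set φ := chartAt ℂ (f z)
  obtain ⟨U, hUo, hzU, hU⟩ := mem_nhdsWithin.1 (he.and he')
  refine ⟨U, hUo.mem_nhds hzU, hUo, fun D' hD' hm => ?_⟩
  have hD'U : ∀ w ∈ D', (f w ∈ ζ.source ∧ teichmullerLinear t (ζ (f w)) = s * w + b) ∧
      f w ∈ φ.source := fun w hw => hU ⟨(hD' hw).2, (hD' hw).1⟩
  have hs0 : s * s = 1 := by rcases hs with rfl | rfl <;> simp
  -- Since `s * s = 1`, the affine map has an explicit inverse; the image becomes a preimage, so its
  -- measurability follows from continuity.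
  have himg : f '' D' = ζ.source ∩ ζ ⁻¹' ((fun y => s * (teichmullerLinear t y - b)) ⁻¹' D') := by
    ext p
    constructor
    · rintro ⟨w, hw, rfl⟩
      refine ⟨(hD'U w hw).1.1, ?_⟩
      change s * (teichmullerLinear t (ζ (f w)) - b) ∈ D'
      rwa [(hD'U w hw).1.2, add_sub_cancel_right, ← mul_assoc, hs0, one_mul]
    · rintro ⟨hp, hw⟩
      refine ⟨_, hw, ζ.injOn (hD'U _ hw).1.1 hp ((teichmullerLinear t).injective ?_)⟩
      rw [(hD'U _ hw).1.2, ← mul_assoc, hs0, one_mul, sub_add_cancel]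
  have hmeas : MeasurableSet (f '' D') := by
    rw [himg]
    refine ζ.continuousOn.measurableSet_inter_preimage ζ.open_source.measurableSet
      (hm.preimage (Continuous.measurable ?_))
    have := (teichmullerLinear t).continuous
    fun_prop
  refine ⟨hmeas, ?_⟩
  rw [area_eq_volume_image hζ hφ hmeas (by rintro _ ⟨w, hw, rfl⟩; exact (hD'U w hw).2)
    (by rintro _ ⟨w, hw, rfl⟩; exact (hD'U w hw).1.1)]
  have hpre : ζ '' (f '' D') = teichmullerLinear t ⁻¹' ((fun w => s * w + b) '' D') := by
    ext y
    simp only [mem_image, mem_preimage, exists_exists_and_eq_and]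
    refine exists_congr fun w => and_congr_right fun hw => ?_
    rw [← (hD'U w hw).1.2, (teichmullerLinear t).injective.eq_iff]
  rw [hpre, (measurePreserving_teichmullerLinear t).measure_preimage_emb
    (teichmullerLinear t).measurableEmbedding, volume_image_affine hs]

/-- A flat map does not increase area, and preserves it if it is injective. -/
theorem IsFlat.area_image (h : q.IsFlat t f D) {D' : Set ℂ} (hD' : D' ⊆ D)
    (hm : MeasurableSet D') :
    MeasurableSet (f '' D') ∧ q.area (f '' D') ≤ volume D' ∧
      (InjOn f D' → q.area (f '' D') = volume D') := by
  choose! U hU hUo hUa using fun z (hz : z ∈ D) => h.exists_nhds_area_image hz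
  rcases D.eq_empty_or_nonempty with rfl | hne
  · simp [subset_eq_empty hD' rfl]
  obtain ⟨S, hSD, hSc, hS⟩ := TopologicalSpace.countable_cover_nhdsWithin
    (fun z hz => mem_nhdsWithin_of_mem_nhds (hU z hz) : ∀ z ∈ D, U z ∈ 𝓝[D] z)
  have hSne : S.Nonempty := by
    obtain ⟨z, hz⟩ := hne
    obtain ⟨x, hx, -⟩ := mem_iUnion₂.1 (hS hz)
    exact ⟨x, hx⟩
  obtain ⟨c, rfl⟩ := hSc.exists_eq_range hSne
  have hcD : ∀ n, c n ∈ D := fun n => hSD (mem_range_self n)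
  -- Disjoint pieces cut from a countable cover. Their images may overlap, which gives only an
  -- inequality unless `f` is injective.
  set P : ℕ → Set ℂ := fun n => D' ∩ disjointed (fun k => U (c k)) n with hP
  have hPm : ∀ n, MeasurableSet (P n) := fun n =>
    hm.inter (MeasurableSet.disjointed (fun k => (hUo _ (hcD k)).measurableSet) n)
  have hPd : Pairwise (Function.onFun Disjoint P) := fun i j hij =>
    ((disjoint_disjointed _) hij).mono inter_subset_right inter_subset_right
  have hPU : ⋃ n, P n = D' := by
    rw [← inter_iUnion, iUnion_disjointed, inter_eq_left]
    exact hD'.trans (by simpa using hS)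
  have hPa : ∀ n, MeasurableSet (f '' P n) ∧ q.area (f '' P n) = volume (P n) := fun n =>
    hUa _ (hcD n) _ (inter_subset_inter hD' (disjointed_subset _ n)) (hPm n)
  have himg : f '' D' = ⋃ n, f '' P n := by rw [← image_iUnion, hPU]
  have hvol : volume D' = ∑' n, volume (P n) := by rw [← measure_iUnion hPd hPm, hPU]
  refine ⟨himg ▸ MeasurableSet.iUnion fun n => (hPa n).1, ?_, fun hinj => ?_⟩
  · rw [himg, hvol]
    exact (measure_iUnion_le _).trans (ENNReal.tsum_le_tsum fun n => (hPa n).2.le)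
  · rw [himg, hvol, measure_iUnion _ fun n => (hPa n).1]
    · exact tsum_congr fun n => (hPa n).2
    · intro i j hij
      exact (hPd hij).image hinj inter_subset_left inter_subset_left

end Flat

end QuadraticDifferential

/-! ### Intervals, slices and rectangles -/

section Interval

variable {a b : ℝ} {K : Set ℝ}

theorem ordConnected_of_Ioo_subset_of_subset_Icc (h₁ : Ioo a b ⊆ K) (h₂ : K ⊆ Icc a b) :
    K.OrdConnected := by
  refine ⟨fun x hx y hy z hz => ?_⟩
  rcases eq_or_lt_of_le ((h₂ hx).1.trans hz.1) with h | h
  · rwa [le_antisymm hz.1 (h ▸ (h₂ hx).1)] at hx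
  rcases eq_or_lt_of_le (hz.2.trans (h₂ hy).2) with h' | h'
  · rwa [le_antisymm (h' ▸ (h₂ hy).2) hz.2] at hy
  exact h₁ ⟨h, h'⟩

theorem volume_of_Ioo_subset_of_subset_Icc (h₁ : Ioo a b ⊆ K) (h₂ : K ⊆ Icc a b) :
    volume K = ENNReal.ofReal (b - a) :=
  le_antisymm ((measure_mono h₂).trans_eq Real.volume_Icc)
    (Real.volume_Ioo.symm.trans_le (measure_mono h₁))

end Interval

/-- Cavalieri's principle for plane sets. -/
theorem Complex.volume_le_of_forall_slice_le {D : Set ℂ} (hD : MeasurableSet D) {H : Set ℝ}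
    (hH : MeasurableSet H) (hDH : ∀ z ∈ D, z.re ∈ H) {C : ℝ≥0∞}
    (hC : ∀ x ∈ H, volume {y : ℝ | (⟨x, y⟩ : ℂ) ∈ D} ≤ C) : volume D ≤ C * volume H := by
  have hm := Complex.measurableEquivRealProd.symm.measurable hD
  rw [← Complex.volume_preserving_equiv_real_prod.symm.measure_preimage hD.nullMeasurableSet,
    Measure.volume_eq_prod, Measure.prod_apply hm, ← lintegral_indicator_const hH]
  refine lintegral_mono fun x => ?_
  by_cases hx : x ∈ H
  · rw [indicator_of_mem hx]
    exact hC x hx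
  · rw [indicator_of_notMem hx, nonpos_iff_eq_zero]
    convert measure_empty (μ := (volume : Measure ℝ))
    exact eq_empty_of_forall_notMem fun y hy => hx (hDH _ hy)

theorem Complex.volume_reProdIm (H V : Set ℝ) : volume (H ×ℂ V) = volume H * volume V := by
  rw [← Complex.volume_preserving_equiv_real_prod.symm.measure_preimage_equiv,
    ← Measure.prod_prod, ← Measure.volume_eq_prod]
  rfl

namespace RectangleMap

variable {Y : Type u} (R : RectangleMap Y)

theorem ordConnected_ver : R.ver.OrdConnected :=
  ordConnected_of_Ioo_subset_of_subset_Icc R.Ioo_subset_ver R.ver_subset_Icc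

theorem measurableSet_hor : MeasurableSet R.hor :=
  (ordConnected_of_Ioo_subset_of_subset_Icc R.Ioo_subset_hor R.hor_subset_Icc).measurableSet

theorem volume_hor : volume R.hor = ENNReal.ofReal R.width :=
  volume_of_Ioo_subset_of_subset_Icc R.Ioo_subset_hor R.hor_subset_Icc

theorem volume_ver : volume R.ver = ENNReal.ofReal R.height :=
  volume_of_Ioo_subset_of_subset_Icc R.Ioo_subset_ver R.ver_subset_Icc

theorem measurableSet_domain : MeasurableSet R.domain :=
  (Complex.measurable_re R.measurableSet_hor).inter
    (Complex.measurable_im R.ordConnected_ver.measurableSet)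

theorem width_pos : 0 < R.width := sub_pos.2 R.left_lt_right

theorem height_pos : 0 < R.height := sub_pos.2 R.bottom_lt_top

theorem volume_domain : volume R.domain = ENNReal.ofReal (R.width * R.height) := by
  rw [domain, Complex.volume_reProdIm, volume_hor, volume_ver, ENNReal.ofReal_mul R.width_pos.le]

variable {R}

/-- The extension shares the set `hor`, whose length recovers the width. -/
theorem IsVerticalExtension.width_eq {B : RectangleMap Y} (h : B.IsVerticalExtension R) :
    B.width = R.width := by
  have := B.volume_hor
  rwa [h.1, R.volume_hor, ENNReal.ofReal_eq_ofReal_iff R.width_pos.le B.width_pos.le, eq_comm]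
    at this

end RectangleMap

/-! ### Areas of pulled-back rectangles and of their intersections -/

namespace QuadraticDifferential

variable {X : Type u} [TopologicalSpace X] [ChartedSpace ℂ X] {q : QuadraticDifferential X}

theorem pullback_eq_image {t : ℝ} (R : RectangleMap (q.FlowSurface t)) :
    q.pullback t R = toBase R '' R.domain := rfl

variable [MeasurableSpace X] [BorelSpace X] [IsManifold 𝓘(ℂ) 1 X] [CompactSpace X] [Nonempty X]

theorem IsRectangle.area_pullback {t : ℝ} {R : RectangleMap (q.FlowSurface t)}
    (h : q.IsRectangle t R) (he : R.IsEmbedded) :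
    q.area (q.pullback t R) = ENNReal.ofReal (R.width * R.height) := by
  rw [← R.volume_domain, pullback_eq_image]
  exact (h.isFlat.area_image subset_rfl R.measurableSet_domain).2.2 he

/-- The intersection of a rectangle of `X_t` with a buffered rectangle of `X_s`. -/
theorem area_pullback_inter_le [T2Space X] {s t α : ℝ} (hα : 0 < α)
    {S : RectangleMap (q.FlowSurface s)} {R : RectangleMap (q.FlowSurface t)}
    (hS : q.IsRectangle s S) (hB : q.IsBuffered s α S) (hR : q.IsRectangle t R) :
    q.area (q.pullback s S ∩ q.pullback t R) ≤ ENNReal.ofReal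
      (8 / α * (S.width * S.height) * (R.width * R.height) +
        8 * S.height * R.width * Real.exp (-((t - s) / 2))) := by
  obtain ⟨B, hBrect, hext, hBα, hover⟩ := hB
  set ρ := Real.exp ((t - s) / 2) with hρdef
  have hρ : 0 < ρ := Real.exp_pos _
  have hAm : MeasurableSet (q.pullback s S) :=
    (hS.isFlat.area_image subset_rfl S.measurableSet_domain).1
  set D := R.domain ∩ toBase R ⁻¹' q.pullback s S with hD
  have hDm : MeasurableSet D :=
    hR.isFlat.continuousOn.measurableSet_inter_preimage R.measurableSet_domain hAm
  have himg : q.pullback s S ∩ q.pullback t R = toBase R '' D := by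
    rw [hD, image_inter_preimage, pullback_eq_image R, inter_comm]
  have hslice : ∀ x ∈ R.hor, volume {y : ℝ | (⟨x, y⟩ : ℂ) ∈ D} ≤
      ENNReal.ofReal ((2 * ρ * R.height / B.height + 2) * (4 * (S.height / ρ))) := by
    intro x hx
    have hf : q.IsVertical (Real.exp (t / 2)) (fun u => toBase R ⟨x, u⟩) (Ioo R.bottom R.top) :=
      hR.isFlat.isVertical x fun u hu => ⟨hx, R.Ioo_subset_ver hu⟩
    have hmain := IsVertical.volume_mem_Ioo_le (Real.exp_pos _).ne' hρ
      (κ' := Real.exp (s / 2)) (by rw [hρdef, ← Real.exp_add]; congr 1; ring) hf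
      (g := toBase B) (H := B.hor) B.ordConnected_ver
      (fun x' hx' => hBrect.isFlat.isVertical x' fun u hu => ⟨hx', hu⟩) hover B.height_pos
      (l := B.bottom) (by simpa [RectangleMap.height] using B.Ioo_subset_ver) S.bottom_lt_top.le
      hext.2.1 S.ver_subset_Icc
    refine le_trans ?_ hmain
    -- The vertical interval of `R` may contain its endpoints; dropping these two parameters costs
    -- no measure. Visits to `S` are read through its extension `B`.
    have hsub : {y : ℝ | (⟨x, y⟩ : ℂ) ∈ D} ⊆ {y | y ∈ Ioo R.bottom R.top ∧
        ∃ z ∈ B.hor ×ℂ S.ver, toBase B z = toBase R ⟨x, y⟩} ∪ {R.bottom, R.top} := by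
      rintro y ⟨hy, z, hz, hzy⟩
      have hyI := R.ver_subset_Icc hy.2
      rcases eq_endpoints_or_mem_Ioo_of_mem_Icc hyI with h | h | h
      · exact Or.inr (Or.inl h)
      · exact Or.inr (Or.inr h)
      · refine Or.inl ⟨h, z, ⟨hext.1 ▸ hz.1, hz.2⟩, ?_⟩
        exact (hext.2.2 hz).trans hzy
    refine (measure_mono hsub).trans ((measure_union_le _ _).trans ?_)
    rw [((toFinite {R.bottom, R.top}).measure_zero volume), add_zero]
  rw [himg]
  refine ((hR.isFlat.area_image inter_subset_left hDm).2.1).trans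
    ((Complex.volume_le_of_forall_slice_le hDm R.measurableSet_hor (fun z hz => hz.1.1)
      hslice).trans ?_)
  have hBh := B.height_pos
  have hSh := S.height_pos
  have hSw := S.width_pos
  have hRh := R.height_pos
  have hRw := R.width_pos
  rw [R.volume_hor, ← ENNReal.ofReal_mul (by positivity)]
  refine ENNReal.ofReal_le_ofReal ?_
  rw [hext.width_eq] at hBα
  -- The only use of the size of the buffer: `B` has the width of `S`, so its height is at least `α
  -- / S.width`.
  have hinv : 1 / B.height ≤ S.width / α := by
    rw [div_le_div_iff₀ hBh hα]; linarith
  have hexp : Real.exp (-((t - s) / 2)) = 1 / ρ := by rw [Real.exp_neg, one_div]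
  rw [hexp]
  calc (2 * ρ * R.height / B.height + 2) * (4 * (S.height / ρ)) * R.width
      = 8 * (R.height * S.height * R.width) * (1 / B.height) +
        8 * S.height * R.width * (1 / ρ) := by field_simp; ring
    _ ≤ 8 * (R.height * S.height * R.width) * (S.width / α) +
        8 * S.height * R.width * (1 / ρ) := by gcongr
    _ = _ := by ring

end QuadraticDifferential

/-! ### Choice of the times and conclusion -/

/-- A sequence of times growing like `n log n` with logarithmically large gaps. -/
theorem exists_sparse_sequence (T : ℝ) : ∃ τ : ℕ → ℝ, (∀ n, T < τ n) ∧ (∀ n, 1 ≤ τ n) ∧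
    Tendsto τ atTop atTop ∧
    (τ =O[atTop] fun n : ℕ => (n : ℝ) * Real.log n * Real.log (Real.log n)) ∧
    ∀ n m : ℕ, n < m → 2 * Real.log (τ m) ≤ τ m - τ n := by
  obtain ⟨M, hM⟩ := exists_nat_gt (max T 3)
  have hMT : T < M := (le_max_left _ _).trans_lt hM
  have hM3 : (3 : ℝ) < M := (le_max_right _ _).trans_lt hM
  have hlog1 : ∀ x : ℝ, 3 ≤ x → 1 ≤ Real.log x := fun x hx => by
    rw [Real.le_log_iff_exp_le (by linarith)]
    linarith [Real.exp_one_lt_d9]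
  have hge : ∀ n : ℕ, (3 : ℝ) ≤ n + M := fun n => by
    have : (0 : ℝ) ≤ n := n.cast_nonneg
    linarith
  have hτge : ∀ n : ℕ, (n : ℝ) + M ≤ 8 * (n + M) * Real.log (n + M) := fun n => by
    nlinarith [hlog1 _ (hge n), hge n]
  have hmono : ∀ n m : ℕ, n ≤ m →
      8 * (n + M : ℝ) * Real.log (n + M) ≤ 8 * (m + M : ℝ) * Real.log (m + M) := fun n m hnm => by
    have h1 : (n : ℝ) ≤ m := by exact_mod_cast hnm
    have h2 := hge n
    have h3 := hlog1 _ h2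
    have h4 : Real.log (n + M) ≤ Real.log (m + M) := Real.log_le_log (by linarith) (by linarith)
    gcongr
  -- The shift `M > max T 3` puts all times beyond `T` and makes the logarithms at least 1. The
  -- factor 8 gives gaps of at least `8 log (x + 1)` for `x = n + M`, against `2 log τ ≤ 4 + 4 log
  -- (x + 1)`.
  refine ⟨fun n => 8 * (n + M) * Real.log (n + M), fun n => ?_, fun n => ?_, ?_, ?_, ?_⟩
  · have : (0 : ℝ) ≤ n := n.cast_nonneg
    linarith [hτge n]
  · linarith [hτge n, hge n]
  · refine tendsto_atTop_mono hτge ?_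
    exact tendsto_atTop_add_const_right _ _ tendsto_natCast_atTop_atTop
  · have hl : Tendsto (fun n : ℕ => Real.log n) atTop atTop :=
      Real.tendsto_log_atTop.comp tendsto_natCast_atTop_atTop
    -- The times are already `O(n log n)`; the iterated logarithm enters only as a factor that is
    -- eventually at least 1.
    have hll := (Real.tendsto_log_atTop.comp hl).eventually_ge_atTop 1
    refine IsBigO.of_bound 32 ?_
    filter_upwards [hll, hl.eventually_ge_atTop 1, eventually_ge_atTop M,
      eventually_ge_atTop 2] with n h1 h2 h3 h4
    have h3' : (M : ℝ) ≤ n := by exact_mod_cast h3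
    have h4' : (2 : ℝ) ≤ n := by exact_mod_cast h4
    simp only [Function.comp] at h1
    have h5 : Real.log (n + M) ≤ 2 * Real.log n := by
      rw [← Real.log_rpow (by linarith)]
      refine Real.log_le_log (by linarith) ?_
      norm_num
      nlinarith
    have h6 := hlog1 _ (hge n)
    rw [Real.norm_of_nonneg (by positivity), Real.norm_of_nonneg (by positivity)]
    calc 8 * (n + M : ℝ) * Real.log (n + M) ≤ 8 * (n + n : ℝ) * (2 * Real.log n) := by gcongr
      _ = 32 * (n * Real.log n * 1) := by ring
      _ ≤ 32 * (n * Real.log n * Real.log (Real.log n)) := by gcongr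
  · intro n m hnm
    -- By monotonicity it suffices to bound the gap between `m` and its predecessor.
    obtain ⟨k, rfl⟩ : ∃ k, m = k + 1 := ⟨m - 1, by omega⟩
    have h1 := hmono n k (by omega)
    have h2 := hge k
    set x : ℝ := k + M with hx
    have hx1 : ((k + 1 : ℕ) : ℝ) + M = x + 1 := by push_cast; ring
    simp only [hx1]
    have h3 := hlog1 x h2
    have h4 := hlog1 (x + 1) (by linarith)
    have h5 : Real.log x ≤ Real.log (x + 1) := Real.log_le_log (by linarith) (by linarith)
    have h6 : Real.log (Real.log (x + 1)) ≤ Real.log (x + 1) - 1 :=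
      Real.log_le_sub_one_of_pos (by linarith)
    have h7 : Real.log 8 ≤ 3 := by
      rw [show (8 : ℝ) = 2 ^ 3 by norm_num, Real.log_pow]
      have := Real.log_two_lt_d9
      push_cast; linarith
    have h8 : Real.log (8 * (x + 1) * Real.log (x + 1)) =
        Real.log 8 + Real.log (x + 1) + Real.log (Real.log (x + 1)) := by
      rw [Real.log_mul (by linarith) (by linarith), Real.log_mul (by norm_num) (by linarith)]
    have h9 : x * Real.log x ≤ x * Real.log (x + 1) := mul_le_mul_of_nonneg_left h5 (by linarith)
    rw [h8]
    nlinarith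

theorem mainTheorem6 (c α : ℝ) (hc : 0 < c) (hα : 0 < α) :
    ∃ K : ℝ, ∀ (X : Type u) [TopologicalSpace X] [T2Space X] [CompactSpace X] [ConnectedSpace X]
      [ChartedSpace ℂ X] [IsManifold 𝓘(ℂ) 1 X] [MeasurableSpace X] [BorelSpace X]
      (q : QuadraticDifferential X), q.area univ = 1 →
      ∀ (ε : ℝ), 0 < ε → ε ≤ 1 →
      ∀ (T : ℝ), 0 ≤ T →
      ∀ (σ : ℝ → ℝ) (S : ∀ t : ℝ, RectangleMap (q.FlowSurface t)),
        (∀ t > T, q.IsRectangle t (S t) ∧ (S t).IsEmbedded ∧ (S t).IsSquare (σ t) ∧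
          q.IsBuffered t α (S t) ∧ c / t ^ (ε / 2) < σ t) →
        ∃ τ : ℕ → ℝ, (∀ n, T < τ n) ∧ Tendsto τ atTop atTop ∧
          (τ =O[atTop] fun n : ℕ => (n : ℝ) * Real.log n * Real.log (Real.log n)) ∧
          ∀ n m : ℕ, n < m →
            q.area (q.pullback (τ n) (S (τ n)) ∩ q.pullback (τ m) (S (τ m))) ≤
              ENNReal.ofReal K * q.area (q.pullback (τ n) (S (τ n))) *
                q.area (q.pullback (τ m) (S (τ m))) := by
  -- The first summand comes from full passages through the buffer, the second from the end effect.
  refine ⟨8 / α + 8 / c ^ 2, ?_⟩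
  intro X _ _ _ _ _ _ _ _ q _ ε hε hε1 T _ σ S hS
  obtain ⟨τ, hτT, hτ1, hτlim, hτO, hτgap⟩ := exists_sparse_sequence T
  refine ⟨τ, hτT, hτlim, hτO, fun n m hnm => ?_⟩
  have hgap := hτgap n m hnm
  obtain ⟨hrs, hes, ⟨hws, hhs⟩, hbs, hσs⟩ := hS (τ n) (hτT n)
  obtain ⟨hrt, het, ⟨hwt, hht⟩, -, hσt⟩ := hS (τ m) (hτT m)
  have hs1 := hτ1 n
  have ht1 := hτ1 m
  set s := τ n
  set t := τ m
  have ht0 : 0 < t := by linarith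
  have hst : s ≤ t := by linarith [Real.log_nonneg ht1]
  -- As `r ≥ 1` and `ε ≤ 1`, one has `r ^ (ε / 2) ≤ r ^ (1 / 2) ≤ t ^ (1 / 2)`; both sides are thus
  -- bounded below in terms of the later time.
  have hσ : ∀ r, 1 ≤ r → r ≤ t → c / r ^ (ε / 2) < σ r → c / t ^ (1 / 2 : ℝ) ≤ σ r := by
    intro r hr1 hrt h
    refine le_trans (div_le_div_of_nonneg_left hc.le (by positivity) ?_) h.le
    exact (Real.rpow_le_rpow_of_exponent_le hr1 (by linarith)).trans
      (Real.rpow_le_rpow (by linarith) hrt (by norm_num))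
  have hσσ : c ^ 2 / t ≤ σ s * σ t := by
    refine le_trans (le_of_eq ?_) (mul_le_mul (hσ s hs1 hst hσs) (hσ t ht1 le_rfl hσt)
      (by positivity) ((le_of_lt (div_pos hc (by positivity))).trans (hσ s hs1 hst hσs)))
    rw [div_mul_div_comm, ← sq, ← Real.rpow_add ht0]
    norm_num
  have hexp : Real.exp (-((t - s) / 2)) ≤ 1 / t := by
    rw [one_div, ← Real.exp_log (inv_pos.2 ht0), Real.log_inv]
    exact Real.exp_le_exp.2 (by linarith)
  have hexp' : Real.exp (-((t - s) / 2)) ≤ σ s * σ t / c ^ 2 := by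
    refine hexp.trans ?_
    rw [div_le_div_iff₀ ht0 (by positivity), one_mul]
    rwa [div_le_iff₀ ht0] at hσσ
  have hσs0 : 0 < σ s := hws ▸ (S s).width_pos
  have hσt0 : 0 < σ t := hwt ▸ (S t).width_pos
  refine (QuadraticDifferential.area_pullback_inter_le hα hrs hbs hrt).trans ?_
  rw [hrs.area_pullback hes, hrt.area_pullback het, ← ENNReal.ofReal_mul (by positivity), hws, hhs,
    hwt, hht, ← ENNReal.ofReal_mul (by positivity)]
  refine ENNReal.ofReal_le_ofReal ?_
  calc 8 / α * (σ s * σ s) * (σ t * σ t) + 8 * σ s * σ t * Real.exp (-((t - s) / 2))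
      ≤ 8 / α * (σ s * σ s) * (σ t * σ t) + 8 * σ s * σ t * (σ s * σ t / c ^ 2) := by gcongr
    _ = (8 / α + 8 / c ^ 2) * (σ s * σ s) * (σ t * σ t) := by ring
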